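/- Let \(U\subsetneq\mathbb C\) and \(U_n\subsetneq\mathbb C\), \(n\in\mathbb N\), be simply connected domains (non-empty, open), and let \(F_n:U\to U_n\), \(n\in\mathbb N\), be holomorphic maps (not necessarily surjective). Let \(\operatorname{dist}_U\) denote the hyperbolic distance of \(U\), that is, \(\operatorname{dist}_U(z,w)=\inf_\gamma\int_\gamma\rho_U(\zeta)\,|d\zeta|\) over the \(C^1\) curves \(\gamma\) in \(U\) from \(z\) to \(w\), where \(\rho_U(\zeta)=\frac{2|\varphi'(\zeta)|}{1-|\varphi(\zeta)|^2}\) for any biholomorphic map \(\varphi\) of \(U\) onto the unit disc (curvature \(-1\)); let \(\operatorname{dist}\) denote Euclidean distance. Then: (1) for all \(z,z_0\in U\), with \(d=\operatorname{dist}_U(z,z_0)\), \[ |F_n(z)-F_n(z_0)|\le 2d\,e^{2d}\operatorname{dist}(F_n(z_0),\partial U_n)\quad\text{for all } n\in\mathbb N; \] (2) if there exists \(z_0\in U\) such that \(\operatorname{dist}(F_n(z_0),\partial U_n)\to0\) as \(n\to\infty\), then for all \(z\in U\), \(|F_n(z)-F_n(z_0)|\to0\) as \(n\to\infty\). -/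

import Mathlib

open Set Filter Topology

/-- `φ` is a Riemann map of `U`: a biholomorphic map of `U` onto the open unit disc, that is, a
holomorphic map `U → 𝔻` with a holomorphic two-sided inverse `ψ : 𝔻 → U`. -/
def IsRiemannMap (U : Set ℂ) (φ : ℂ → ℂ) : Prop :=
  DifferentiableOn ℂ φ U ∧ MapsTo φ U (Metric.ball 0 1) ∧
    ∃ ψ : ℂ → ℂ, DifferentiableOn ℂ ψ (Metric.ball 0 1) ∧ MapsTo ψ (Metric.ball 0 1) U ∧
      InvOn ψ φ U (Metric.ball 0 1)

open Classical in
/-- The hyperbolic density `ρ_U` (of curvature `-1`) of a simply connected domain `U ≠ ℂ`: the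
pull-back `2 |φ'(z)| / (1 - |φ(z)|²)` of the density `2 / (1 - |w|²)` of the unit disc under a
Riemann map `φ` of `U`. It does not depend on the choice of `φ`, see `hyperbolicDensity_eq`. -/
noncomputable def hyperbolicDensity (U : Set ℂ) (z : ℂ) : ℝ :=
  if h : ∃ φ : ℂ → ℂ, IsRiemannMap U φ then
    2 * ‖deriv h.choose z‖ / (1 - ‖h.choose z‖ ^ 2)
  else 0

/-- The hyperbolic length `∫_γ ρ_U(ζ) |dζ|` of a curve `γ : [0, 1] → U`. -/
noncomputable def hyperbolicLength (U : Set ℂ) (γ : ℝ → ℂ) : ℝ :=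
  ∫ t in (0 : ℝ)..1, hyperbolicDensity U (γ t) * ‖derivWithin γ (Icc 0 1) t‖

/-- The hyperbolic distance `dist_U(z, w)`: the infimum of the hyperbolic lengths of the `C¹` curves
`γ : [0, 1] → U` from `z` to `w`. -/
noncomputable def hyperbolicDist (U : Set ℂ) (z w : ℂ) : ℝ :=
  sInf (hyperbolicLength U '' {γ : ℝ → ℂ | ContDiffOn ℝ 1 γ (Icc 0 1) ∧ MapsTo γ (Icc 0 1) U ∧
    γ 0 = z ∧ γ 1 = w})

/-- The disc automorphism `w ↦ (w - c) / (1 - c̄ w)` maps the disc into itself, with derivative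
`(1 - |c|²) / (1 - c̄ w)²`. -/
lemma discAutomorphism_aux {c w : ℂ} (hc : ‖c‖ < 1) (hw : ‖w‖ < 1) :
    1 - (starRingEnd ℂ) c * w ≠ 0 ∧ ‖(w - c) / (1 - (starRingEnd ℂ) c * w)‖ < 1 ∧
      HasDerivAt (fun u : ℂ => (u - c) / (1 - (starRingEnd ℂ) c * u))
        ((1 - (starRingEnd ℂ) c * c) / (1 - (starRingEnd ℂ) c * w) ^ 2) w := by
  have hne : 1 - (starRingEnd ℂ) c * w ≠ 0 := by
    intro h
    have h1 : ‖(starRingEnd ℂ) c * w‖ = 1 := by rw [← sub_eq_zero.1 h, norm_one]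
    rw [norm_mul, RCLike.norm_conj] at h1
    nlinarith [norm_nonneg c, norm_nonneg w]
  refine ⟨hne, ?_, ?_⟩
  · rw [norm_div, div_lt_one (norm_pos_iff.2 hne), ← abs_norm, ← abs_norm (1 - _), ← sq_lt_sq]
    have h1 : ‖c‖ ^ 2 < 1 := by nlinarith [norm_nonneg c]
    have h2 : ‖w‖ ^ 2 < 1 := by nlinarith [norm_nonneg w]
    rw [Complex.sq_norm, Complex.normSq_apply] at h1 h2 ⊢
    rw [Complex.sq_norm, Complex.normSq_apply]
    simp only [Complex.sub_re, Complex.sub_im, Complex.mul_re, Complex.mul_im, Complex.conj_re,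
      Complex.conj_im, Complex.one_re, Complex.one_im]
    nlinarith [mul_pos (sub_pos.2 h1) (sub_pos.2 h2)]
  · have h1 : HasDerivAt (fun u : ℂ => u - c) 1 w := (hasDerivAt_id w).sub_const c
    have h2 : HasDerivAt (fun u : ℂ => 1 - (starRingEnd ℂ) c * u) (-((starRingEnd ℂ) c * 1)) w :=
      ((hasDerivAt_id w).const_mul _).const_sub 1
    refine (h1.div h2 hne).congr_deriv ?_
    ring

lemma one_sub_conj_mul_self (c : ℂ) :
    1 - (starRingEnd ℂ) c * c = ((1 - ‖c‖ ^ 2 : ℝ) : ℂ) := by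
  rw [← Complex.normSq_eq_conj_mul_self, Complex.normSq_eq_norm_sq]
  push_cast; rfl

/-- The Schwarz–Pick inequality for two Riemann maps of the same domain. -/
lemma IsRiemannMap.density_le {U : Set ℂ} (hU : IsOpen U) {φ χ : ℂ → ℂ}
    (hφ : IsRiemannMap U φ) (hχ : IsRiemannMap U χ) {z : ℂ} (hz : z ∈ U) :
    2 * ‖deriv χ z‖ / (1 - ‖χ z‖ ^ 2) ≤ 2 * ‖deriv φ z‖ / (1 - ‖φ z‖ ^ 2) := by
  obtain ⟨hφd, hφm, ψ, hψd, hψm, hinv⟩ := hφ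
  obtain ⟨hχd, hχm, -⟩ := hχ
  have ha : ‖φ z‖ < 1 := mem_ball_zero_iff.1 (hφm hz)
  have hb : ‖χ z‖ < 1 := mem_ball_zero_iff.1 (hχm hz)
  have ha' : ‖-φ z‖ < 1 := by rwa [norm_neg]
  set S : ℂ → ℂ := fun u => (u - -φ z) / (1 - (starRingEnd ℂ) (-φ z) * u) with hS
  set T : ℂ → ℂ := fun u => (u - χ z) / (1 - (starRingEnd ℂ) (χ z) * u) with hT
  have hS0 : S 0 = φ z := by simp [hS]
  have hTb : T (χ z) = 0 := by simp [hT]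
  have hψz : ψ (φ z) = z := hinv.1 hz
  have hSm : MapsTo S (Metric.ball 0 1) (Metric.ball 0 1) := fun w hw =>
    mem_ball_zero_iff.2 (discAutomorphism_aux ha' (mem_ball_zero_iff.1 hw)).2.1
  have hTm : MapsTo T (Metric.ball 0 1) (Metric.ball 0 1) := fun w hw =>
    mem_ball_zero_iff.2 (discAutomorphism_aux hb (mem_ball_zero_iff.1 hw)).2.1
  have hSd : DifferentiableOn ℂ S (Metric.ball 0 1) := fun w hw =>
    (discAutomorphism_aux ha' (mem_ball_zero_iff.1 hw)).2.2.differentiableAt.differentiableWithinAt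
  have hTd : DifferentiableOn ℂ T (Metric.ball 0 1) := fun w hw =>
    (discAutomorphism_aux hb (mem_ball_zero_iff.1 hw)).2.2.differentiableAt.differentiableWithinAt
  have hfd : DifferentiableOn ℂ (T ∘ χ ∘ ψ ∘ S) (Metric.ball 0 1) :=
    hTd.comp (hχd.comp (hψd.comp hSd hSm) (hψm.comp hSm)) (hχm.comp (hψm.comp hSm))
  have hfm : MapsTo (T ∘ χ ∘ ψ ∘ S) (Metric.ball 0 1) (Metric.ball 0 1) :=
    hTm.comp (hχm.comp (hψm.comp hSm))
  have hf0 : (T ∘ χ ∘ ψ ∘ S) 0 = 0 := by simp [hS0, hψz, hTb]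
  have hle : ‖deriv (T ∘ χ ∘ ψ ∘ S) 0‖ ≤ 1 :=
    Complex.norm_deriv_le_one_of_mapsTo_ball (c := 0) hfd
      (by rw [hf0]; exact hfm.mono_right Metric.ball_subset_closedBall) one_pos
  have hψd' : HasDerivAt ψ (deriv ψ (φ z)) (φ z) :=
    (hψd.differentiableAt (Metric.isOpen_ball.mem_nhds (hφm hz))).hasDerivAt
  have hχd' : HasDerivAt χ (deriv χ z) z := (hχd.differentiableAt (hU.mem_nhds hz)).hasDerivAt
  have hφd' : HasDerivAt φ (deriv φ z) z := (hφd.differentiableAt (hU.mem_nhds hz)).hasDerivAt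
  have hone : deriv ψ (φ z) * deriv φ z = 1 := by
    refine (hψd'.comp z hφd').unique ((hasDerivAt_id z).congr_of_eventuallyEq ?_)
    filter_upwards [hU.mem_nhds hz] with w hw using hinv.1 hw
  have hSder := (discAutomorphism_aux ha' (w := 0) (by simp)).2.2
  have hTder := (discAutomorphism_aux hb hb).2.2
  have e1 : HasDerivAt (ψ ∘ S) (deriv ψ (φ z) * _) 0 :=
    HasDerivAt.comp (0 : ℂ) (by rw [hS0]; exact hψd') hSder
  have e2 : HasDerivAt (χ ∘ ψ ∘ S) (deriv χ z * _) 0 :=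
    HasDerivAt.comp (0 : ℂ) (by rw [Function.comp_apply, hS0, hψz]; exact hχd') e1
  have hchain := (HasDerivAt.comp (0 : ℂ) (h₂ := T) (h := χ ∘ ψ ∘ S)
    (by rw [Function.comp_apply, Function.comp_apply, hS0, hψz]; exact hTder) e2).deriv
  rw [hchain] at hle
  have hA : 0 < 1 - ‖φ z‖ ^ 2 := by nlinarith [norm_nonneg (φ z)]
  have hB : 0 < 1 - ‖χ z‖ ^ 2 := by nlinarith [norm_nonneg (χ z)]
  have hn : ‖deriv ψ (φ z)‖ * ‖deriv φ z‖ = 1 := by rw [← norm_mul, hone, norm_one]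
  rw [one_sub_conj_mul_self, one_sub_conj_mul_self] at hle
  simp only [norm_mul, norm_div, norm_pow, Complex.norm_real, Real.norm_eq_abs, norm_neg,
    abs_of_pos hA, abs_of_pos hB, mul_zero, sub_zero, one_pow, div_one] at hle
  have hle' : ‖deriv χ z‖ * ‖deriv ψ (φ z)‖ * (1 - ‖φ z‖ ^ 2) ≤ 1 - ‖χ z‖ ^ 2 := by
    have : (1 - ‖χ z‖ ^ 2) / (1 - ‖χ z‖ ^ 2) ^ 2 = (1 - ‖χ z‖ ^ 2)⁻¹ := by
      field_simp
    rw [this, inv_mul_le_iff₀ hB] at hle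
    linarith
  rw [div_le_div_iff₀ hB hA]
  have h3 := mul_le_mul_of_nonneg_right hle' (norm_nonneg (deriv φ z))
  have h4 : ‖deriv χ z‖ * ‖deriv ψ (φ z)‖ * (1 - ‖φ z‖ ^ 2) * ‖deriv φ z‖
      = ‖deriv χ z‖ * (1 - ‖φ z‖ ^ 2) := by
    linear_combination ‖deriv χ z‖ * (1 - ‖φ z‖ ^ 2) * hn
  rw [h4] at h3
  linarith

/-- The hyperbolic density is well defined: any Riemann map computes it. -/
theorem hyperbolicDensity_eq {U : Set ℂ} (hU : IsOpen U) {φ : ℂ → ℂ} (hφ : IsRiemannMap U φ)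
    {z : ℂ} (hz : z ∈ U) :
    hyperbolicDensity U z = 2 * ‖deriv φ z‖ / (1 - ‖φ z‖ ^ 2) := by
  have h : ∃ φ : ℂ → ℂ, IsRiemannMap U φ := ⟨φ, hφ⟩
  rw [hyperbolicDensity, dif_pos h]
  exact le_antisymm (hφ.density_le hU h.choose_spec hz) (h.choose_spec.density_le hU hφ hz)

/-! The estimate integrates an infinitesimal one: for holomorphic F : U → V between simply connected
proper domains, |F'(z)| ≤ 2 ρ_U(z) dist(F(z), ∂V). Distance to ∂V is 1-Lipschitz, so along a curve
ending at z₀ the speed of F ∘ γ is at most 2 ρ_U |γ'| times dist(F(z₀), ∂V) plus the length of the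
image still to be run. Grönwall's inequality bounds the image length by (e^{2L} - 1) dist(F(z₀),
∂V), where L is the hyperbolic length of γ; then e^x - 1 ≤ x e^x, and L tends to its infimum.

The infinitesimal bound is Koebe's one-quarter theorem, transported to the disc by a Riemann map of
U centred at z. By Schwarz's lemma, a holomorphic map of the disc into V has derivative at 0 no
larger than that of the Riemann map of V centred at the same value. If V omits a, a branch s of √(z
- a) on V never takes both a value and its negative, so q = (s - s(z₀)) / (s + s(z₀)) satisfies q(z)
q(w) ≠ 1. Composing q with the Riemann map gives a univalent Bieberbach–Eilenberg function p, and
|p'(0)| ≤ 1 is exactly the constant 4.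

That last inequality compares areas for |dw|²/|w|²: the images of a thin-holed annulus under p and
1/p are disjoint, have large logarithmic area, and lie in one common annulus.

Riemann maps are produced by maximizing |f'(z₀)| over normalized univalent maps into the disc. -/

/-! ### Normal families and Hurwitz's theorem -/

/-- A uniformly bounded family of holomorphic functions converges locally uniformly along every
ultrafilter. -/
lemma exists_tendstoLocallyUniformlyOn_of_norm_le {ι : Type*} {U : Set ℂ} (hU : IsOpen U)
    {F : ι → ℂ → ℂ} (hd : ∀ i, DifferentiableOn ℂ (F i) U) {M : ℝ}
    (hb : ∀ i, ∀ z ∈ U, ‖F i z‖ ≤ M) (l : Ultrafilter ι) :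
    ∃ g : ℂ → ℂ, TendstoLocallyUniformlyOn F g l U := by
  -- Each orbit lies in a compact disc, so an ultrafilter gives pointwise limits with no extraction
  -- of subsequences.
  have hlim : ∀ z, ∃ w, z ∈ U → Tendsto (fun i => F i z) l (𝓝 w) := by
    intro z
    by_cases hz : z ∈ U
    · obtain ⟨w, -, hw⟩ := (isCompact_closedBall (0 : ℂ) M).ultrafilter_le_nhds
        (l.map fun i => F i z) (by
          rw [Filter.le_principal_iff, Ultrafilter.coe_map]
          exact Filter.mem_map.2
            (Filter.univ_mem' fun i => mem_closedBall_zero_iff.2 (hb i z hz)))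
      exact ⟨w, fun _ => hw⟩
    · exact ⟨0, fun h => (hz h).elim⟩
  choose g hg using hlim
  refine ⟨g, Metric.tendstoLocallyUniformlyOn_iff.2 fun ε hε x hx => ?_⟩
  obtain ⟨r, hr, hrU⟩ := Metric.isOpen_iff.1 hU x hx
  have hM : 0 ≤ M := by
    obtain ⟨i⟩ : Nonempty ι := Filter.nonempty_of_neBot (l : Filter ι)
    exact (norm_nonneg _).trans (hb i x hx)
  -- Schwarz's lemma gives a Lipschitz constant independent of `i`; this equicontinuity upgrades
  -- pointwise to locally uniform convergence.
  have hlip : ∀ i, ∀ y ∈ Metric.ball x r, dist (F i y) (F i x) ≤ 2 * M / r * dist y x :=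
    fun i y hy => Complex.dist_le_div_mul_dist_of_mapsTo_ball ((hd i).mono hrU)
      (fun w hw => by
        rw [Metric.mem_closedBall, dist_eq_norm]
        linarith [norm_sub_le (F i w) (F i x), hb i w (hrU hw), hb i x hx]) hy
  obtain ⟨δ, hδ, hδε⟩ : ∃ δ > 0, 2 * M / r * δ ≤ ε / 4 := by
    refine ⟨ε / 4 / (2 * M / r + 1), by positivity, ?_⟩
    rw [mul_div_assoc', div_le_iff₀ (by positivity)]
    nlinarith
  have hsmall : ∀ i, ∀ y ∈ Metric.ball x (min r δ), dist (F i y) (F i x) ≤ ε / 4 := by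
    intro i y hy
    have h1 := hlip i y (Metric.ball_subset_ball (min_le_left _ _) hy)
    have h2 : dist y x ≤ δ := (Metric.mem_ball.1 hy).le.trans (min_le_right _ _)
    exact h1.trans ((mul_le_mul_of_nonneg_left h2 (by positivity)).trans hδε)
  refine ⟨_, mem_nhdsWithin_of_mem_nhds (Metric.ball_mem_nhds x (lt_min hr hδ)), ?_⟩
  filter_upwards [(Metric.tendsto_nhds.1 (hg x hx)) (ε / 4) (by positivity)] with i hi y hy
  have hyU : y ∈ U := hrU (Metric.ball_subset_ball (min_le_left _ _) hy)
  have h1 : dist (g y) (g x) ≤ ε / 4 :=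
    le_of_tendsto ((hg y hyU).dist (hg x hx)) (Eventually.of_forall fun j => hsmall j y hy)
  have h2 := hsmall i y hy
  have h3 := dist_triangle4 (g y) (g x) (F i x) (F i y)
  rw [dist_comm (g x) (F i x), dist_comm (F i x) (F i y)] at h3
  linarith

/-- A local form of Hurwitz's theorem: zeros persist under locally uniform limits. -/
lemma TendstoLocallyUniformlyOn.eventually_exists_eq_zero {ι : Type*} {l : Filter ι} [l.NeBot]
    {U : Set ℂ} (hU : IsOpen U) {F : ι → ℂ → ℂ} {g : ℂ → ℂ}
    (h : TendstoLocallyUniformlyOn F g l U) (hd : ∀ i, DifferentiableOn ℂ (F i) U)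
    {w : ℂ} (hw : w ∈ U) (hgw : g w = 0) (hne : ¬ ∀ᶠ z in 𝓝 w, g z = 0) {r : ℝ} (hr : 0 < r) :
    ∀ᶠ i in l, ∃ z ∈ Metric.closedBall w r ∩ U, F i z = 0 := by
  have hg : DifferentiableOn ℂ g U := h.differentiableOn (Eventually.of_forall hd) hU
  have hiso := ((hg.analyticOnNhd hU w hw).eventually_eq_zero_or_eventually_ne_zero).resolve_left hne
  have hev : ∀ᶠ z in 𝓝 w, z ∈ U ∧ (z ≠ w → g z ≠ 0) :=
    (hU.eventually_mem hw).and (eventually_nhdsWithin_iff.1 hiso)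
  obtain ⟨s, hs, hsub⟩ := Metric.nhds_basis_closedBall.mem_iff.1 hev
  set ρ := min r s
  have hρ : 0 < ρ := lt_min hr hs
  have hball : Metric.closedBall w ρ ⊆ Metric.closedBall w s :=
    Metric.closedBall_subset_closedBall (min_le_right _ _)
  have hballU : Metric.closedBall w ρ ⊆ U := fun z hz => (hsub (hball hz)).1
  obtain ⟨x, hx, hmin⟩ := (isCompact_sphere w ρ).exists_isMinOn
    (NormedSpace.sphere_nonempty.2 hρ.le)
    (hg.continuousOn.norm.mono (Metric.sphere_subset_closedBall.trans hballU))
  have hε : 0 < ‖g x‖ := norm_pos_iff.2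
    ((hsub (hball (Metric.sphere_subset_closedBall hx))).2 (Metric.ne_of_mem_sphere hx hρ.ne'))
  have hunif := (tendstoLocallyUniformlyOn_iff_forall_isCompact hU).1 h _ hballU
    (isCompact_closedBall w ρ)
  filter_upwards [Metric.tendstoUniformlyOn_iff.1 hunif (‖g x‖ / 2) (by positivity)] with i hi
  by_contra! hcon
  have hnz : ∀ z ∈ Metric.closedBall w ρ, F i z ≠ 0 := fun z hz =>
    hcon z ⟨Metric.closedBall_subset_closedBall (min_le_left _ _) hz, hballU hz⟩
  -- Without zeros, the maximum principle for 1/F i bounds |F i w| below by half the minimum of |g|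
  -- on the circle, but F i w is close to g w = 0.
  have hdc : DiffContOnCl ℂ (fun z => (F i z)⁻¹) (Metric.ball w ρ) := by
    refine DifferentiableOn.diffContOnCl ?_
    rw [closure_ball w hρ.ne']
    exact ((hd i).mono hballU).inv hnz
  have hbound := Complex.norm_le_of_forall_mem_frontier_norm_le Metric.isBounded_ball hdc
    (C := (‖g x‖ / 2)⁻¹) (fun z hz => by
      rw [frontier_ball w hρ.ne'] at hz
      have h1 := hi z (Metric.sphere_subset_closedBall hz)
      have h2 : ‖g x‖ ≤ ‖g z‖ := hmin hz
      rw [dist_eq_norm] at h1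
      rw [norm_inv]
      refine inv_anti₀ (by positivity) ?_
      linarith [norm_sub_norm_le (g z) (F i z)])
    (subset_closure (Metric.mem_ball_self hρ))
  have h0 := hi w (Metric.mem_closedBall_self hρ.le)
  rw [hgw, dist_zero_left] at h0
  rw [norm_inv] at hbound
  have h3 := norm_pos_iff.2 (hnz w (Metric.mem_closedBall_self hρ.le))
  linarith [(inv_le_inv₀ h3 (by positivity)).1 hbound]

/-! ### Square roots on simply connected domains -/

/-- A continuous square root of a function with a derivative is differentiable away from zeros. -/
lemma HasDerivAt.of_sq_eq {s h : ℂ → ℂ} {h' z : ℂ} (hs : ContinuousAt s z)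
    (hh : HasDerivAt h h' z) (hsq : ∀ w, s w ^ 2 = h w) (hz : s z ≠ 0) :
    HasDerivAt s (h' / (2 * s z)) z := by
  rw [hasDerivAt_iff_tendsto_slope] at hh ⊢
  have h1 : Tendsto (fun w => s w + s z) (𝓝[≠] z) (𝓝 (2 * s z)) := by
    rw [two_mul]
    exact (hs.tendsto.mono_left nhdsWithin_le_nhds).add tendsto_const_nhds
  -- The slope of s is the slope of s² divided by s w + s z.
  refine (hh.div h1 (mul_ne_zero two_ne_zero hz)).congr' ?_
  filter_upwards [h1.eventually_ne (mul_ne_zero two_ne_zero hz)] with w hw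
  rw [Pi.div_apply, slope_def_field, slope_def_field, ← hsq, ← hsq, sq_sub_sq]
  field_simp

/-- A simply connected domain omitting `a` carries a univalent function `q` vanishing at a given
point `z₀`, with `q z * q w ≠ 1` for all `z, w`, and with derivative `1 / (4 (z₀ - a))` at `z₀`. -/
lemma exists_injOn_mul_ne_one {U : Set ℂ} (hUo : IsOpen U) (hUc : IsSimplyConnected U) {a z₀ : ℂ}
    (ha : a ∉ U) (hz₀ : z₀ ∈ U) :
    ∃ q : ℂ → ℂ, DifferentiableOn ℂ q U ∧ InjOn q U ∧ q z₀ = 0 ∧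
      (∀ z ∈ U, ∀ w ∈ U, q z * q w ≠ 1) ∧ (∀ z ∈ U, deriv q z ≠ 0) ∧
      HasDerivAt q (1 / (4 * (z₀ - a))) z₀ := by
  obtain ⟨s, hsc, hsq⟩ := Complex.exists_continuousOn_pow_eq hUc hUo (g := fun z => z - a)
    (by fun_prop) (by rintro ⟨z, hz, h⟩; exact ha (sub_eq_zero.1 h ▸ hz)) two_ne_zero
  have hs0 : ∀ z ∈ U, s z ≠ 0 := by
    intro z hz h
    have := hsq z
    rw [h] at this
    exact ha (by rwa [← sub_eq_zero.1 (this.symm.trans (by simp))])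
  have hinj : ∀ z w, s z ^ 2 = s w ^ 2 → z = w := by
    intro z w h
    rw [hsq, hsq] at h
    exact sub_left_injective h
  have hadd : ∀ z ∈ U, ∀ w ∈ U, s z + s w ≠ 0 := by
    intro z hz w hw h
    obtain rfl := hinj z w (by rw [eq_neg_of_add_eq_zero_left h, neg_sq])
    exact hs0 z hz (by linear_combination h / 2)
  have hsd : ∀ z ∈ U, HasDerivAt s (1 / (2 * s z)) z := fun z hz =>
    HasDerivAt.of_sq_eq (hsc.continuousAt (hUo.mem_nhds hz)) ((hasDerivAt_id z).sub_const a) hsq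
      (hs0 z hz)
  have hqd : ∀ z ∈ U, HasDerivAt (fun z => (s z - s z₀) / (s z + s z₀))
      (s z₀ / (s z * (s z + s z₀) ^ 2)) z := by
    intro z hz
    refine (((hsd z hz).sub_const (s z₀)).div ((hsd z hz).add_const (s z₀))
      (hadd z hz z₀ hz₀)).congr_deriv ?_
    have := hs0 z hz
    have := hadd z hz z₀ hz₀
    field_simp
    ring
  refine ⟨_, fun z hz => (hqd z hz).differentiableAt.differentiableWithinAt, ?_, by simp, ?_, ?_, ?_⟩
  · intro z hz w hw h
    simp only at h
    rw [div_eq_div_iff (hadd z hz z₀ hz₀) (hadd w hw z₀ hz₀)] at h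
    refine hinj z w ?_
    have h2 : s z = s w :=
      mul_left_cancel₀ (mul_ne_zero two_ne_zero (hs0 z₀ hz₀)) (by linear_combination h)
    rw [h2]
  · intro z hz w hw h
    rw [div_mul_div_comm, div_eq_one_iff_eq
      (mul_ne_zero (hadd z hz z₀ hz₀) (hadd w hw z₀ hz₀))] at h
    -- Cleared of denominators, q z * q w = 1 reads 2 s(z₀) (s z + s w) = 0.
    refine mul_ne_zero (mul_ne_zero two_ne_zero (hs0 z₀ hz₀)) (hadd z hz w hw) ?_
    linear_combination -h
  · intro z hz
    rw [(hqd z hz).deriv]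
    exact div_ne_zero (hs0 z₀ hz₀) (mul_ne_zero (hs0 z hz) (pow_ne_zero 2 (hadd z hz z₀ hz₀)))
  · refine (hqd z₀ hz₀).congr_deriv ?_
    rw [← hsq z₀]
    have := hs0 z₀ hz₀
    field_simp
    ring

/-! ### The Riemann mapping theorem -/

/-- The normalized univalent functions from `U` to the disc, of the Riemann mapping theorem. -/
structure IsDiscEmbedding (U : Set ℂ) (z₀ : ℂ) (f : ℂ → ℂ) : Prop where
  differentiableOn : DifferentiableOn ℂ f U
  mapsTo : MapsTo f U (Metric.ball 0 1)
  injOn : InjOn f U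
  deriv_ne_zero : ∀ z ∈ U, deriv f z ≠ 0
  map_base : f z₀ = 0

/-- The image of q contains a disc of radius ε about 0, and q z * q w ≠ 1 keeps q away from the
inverses of its points; so |q| < 1/ε, and ε q is the map sought. -/
lemma exists_isDiscEmbedding {U : Set ℂ} (hUo : IsOpen U) (hUc : IsSimplyConnected U)
    (hUne : U ≠ univ) {z₀ : ℂ} (hz₀ : z₀ ∈ U) : ∃ f, IsDiscEmbedding U z₀ f := by
  obtain ⟨a, ha⟩ := (ne_univ_iff_exists_notMem U).1 hUne
  obtain ⟨q, hqd, hqi, hq0, hq1, hq', -⟩ := exists_injOn_mul_ne_one hUo hUc ha hz₀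
  have hst : HasStrictDerivAt q (deriv q z₀) z₀ :=
    (hqd.analyticOnNhd hUo z₀ hz₀).hasStrictDerivAt
  have himg : q '' U ∈ 𝓝 (0 : ℂ) := by
    rw [← hq0, ← hst.map_nhds_eq (hq' z₀ hz₀)]
    exact image_mem_map (hUo.mem_nhds hz₀)
  obtain ⟨ε, hε, hball⟩ := Metric.nhds_basis_closedBall.mem_iff.1 himg
  have hεb : ∀ z ∈ U, ‖q z‖ < ε⁻¹ := by
    intro z hz
    by_contra! h
    have hpos : 0 < ‖q z‖ := (inv_pos.2 hε).trans_le h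
    obtain ⟨w, hw, hqw⟩ := hball (show (q z)⁻¹ ∈ Metric.closedBall 0 ε by
      rw [mem_closedBall_zero_iff, norm_inv]
      exact inv_le_of_inv_le₀ hε h)
    exact hq1 z hz w hw (by rw [hqw, mul_inv_cancel₀ (norm_pos_iff.1 hpos)])
  refine ⟨fun z => ε * q z, hqd.const_mul _, ?_, ?_, ?_, by simp [hq0]⟩
  · intro z hz
    rw [mem_ball_zero_iff, norm_mul, Complex.norm_real, Real.norm_of_nonneg hε.le]
    calc ε * ‖q z‖ < ε * ε⁻¹ := mul_lt_mul_of_pos_left (hεb z hz) hε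
      _ = 1 := mul_inv_cancel₀ hε.ne'
  · intro z hz w hw h
    exact hqi hz hw (mul_left_cancel₀ (by exact_mod_cast hε.ne') h)
  · intro z hz
    rw [deriv_const_mul _ (hqd.differentiableAt (hUo.mem_nhds hz))]
    exact mul_ne_zero (by exact_mod_cast hε.ne') (hq' z hz)

lemma discAutomorphism_injOn {c : ℂ} (hc : ‖c‖ < 1) :
    InjOn (fun u : ℂ => (u - c) / (1 - (starRingEnd ℂ) c * u)) (Metric.ball 0 1) := by
  intro z hz w hw h
  simp only at h
  rw [div_eq_div_iff (discAutomorphism_aux hc (mem_ball_zero_iff.1 hz)).1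
    (discAutomorphism_aux hc (mem_ball_zero_iff.1 hw)).1] at h
  exact mul_left_cancel₀ (discAutomorphism_aux hc hc).1 (by linear_combination h)

/-- A normalized univalent function omitting a value of the disc does not have maximal derivative. -/
lemma IsDiscEmbedding.exists_norm_deriv_lt {U : Set ℂ} (hUo : IsOpen U)
    (hUc : IsSimplyConnected U) {z₀ : ℂ} (hz₀ : z₀ ∈ U) {f : ℂ → ℂ} (hf : IsDiscEmbedding U z₀ f)
    {c : ℂ} (hc : ‖c‖ < 1) (hcf : c ∉ f '' U) :
    ∃ k, IsDiscEmbedding U z₀ k ∧ ‖deriv f z₀‖ < ‖deriv k z₀‖ := by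
  have hfn : ∀ z ∈ U, ‖f z‖ < 1 := fun z hz => mem_ball_zero_iff.1 (hf.mapsTo hz)
  set h : ℂ → ℂ := fun z => (f z - c) / (1 - (starRingEnd ℂ) c * f z) with hh
  have hhd : ∀ z ∈ U, HasDerivAt h
      ((1 - (starRingEnd ℂ) c * c) / (1 - (starRingEnd ℂ) c * f z) ^ 2 * deriv f z) z :=
    fun z hz => (discAutomorphism_aux hc (hfn z hz)).2.2.comp z
      (hf.differentiableOn.differentiableAt (hUo.mem_nhds hz)).hasDerivAt
  have hhi : InjOn h U := (discAutomorphism_injOn hc).comp hf.injOn hf.mapsTo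
  have hh0 : ∀ z ∈ U, h z ≠ 0 := fun z hz h0 => by
    rcases div_eq_zero_iff.1 h0 with h0 | h0
    · exact hcf ⟨z, hz, sub_eq_zero.1 h0⟩
    · exact (discAutomorphism_aux hc (hfn z hz)).1 h0
  obtain ⟨s, hsc, hsq⟩ := Complex.exists_continuousOn_pow_eq hUc hUo (g := h)
    (fun z hz => (hhd z hz).continuousAt.continuousWithinAt)
    (by rintro ⟨z, hz, h0⟩; exact hh0 z hz h0) two_ne_zero
  have hs0 : ∀ z ∈ U, s z ≠ 0 := fun z hz h0 => hh0 z hz (by rw [← hsq, h0]; simp)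
  have hsd : ∀ z ∈ U, HasDerivAt s _ z := fun z hz =>
    HasDerivAt.of_sq_eq (hsc.continuousAt (hUo.mem_nhds hz)) (hhd z hz) hsq (hs0 z hz)
  have hsn : ∀ z ∈ U, ‖s z‖ < 1 := fun z hz => by
    have h1 : ‖s z‖ ^ 2 < 1 := by
      rw [← norm_pow, hsq]
      exact (discAutomorphism_aux hc (hfn z hz)).2.1
    nlinarith [norm_nonneg (s z)]
  have hsm : MapsTo s U (Metric.ball 0 1) := fun z hz => mem_ball_zero_iff.2 (hsn z hz)
  have hsi : InjOn s U := fun z hz w hw h => hhi hz hw (by rw [← hsq, h, hsq])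
  have hb := hsn z₀ hz₀
  -- Koebe's square-root trick: send c to 0, take a root of the zero-free result, then move the base
  -- value back to 0.
  set k : ℂ → ℂ := fun z => (s z - s z₀) / (1 - (starRingEnd ℂ) (s z₀) * s z) with hk
  have hkd : ∀ z ∈ U, HasDerivAt k _ z := fun z hz =>
    (discAutomorphism_aux hb (hsn z hz)).2.2.comp z (hsd z hz)
  refine ⟨k, ⟨fun z hz => (hkd z hz).differentiableAt.differentiableWithinAt, fun z hz =>
    mem_ball_zero_iff.2 (discAutomorphism_aux hb (hsn z hz)).2.1,
    (discAutomorphism_injOn hb).comp hsi hsm, fun z hz => ?_, by simp [hk]⟩, ?_⟩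
  · rw [(hkd z hz).deriv]
    have h1 := (discAutomorphism_aux hb hb).1
    have h2 := (discAutomorphism_aux hb (hsn z hz)).1
    have h3 := (discAutomorphism_aux hc hc).1
    have h4 := (discAutomorphism_aux hc (hfn z hz)).1
    have h5 := hf.deriv_ne_zero z hz
    have h6 := hs0 z hz
    exact mul_ne_zero (div_ne_zero h1 (pow_ne_zero 2 h2)) (div_ne_zero (mul_ne_zero
      (div_ne_zero h3 (pow_ne_zero 2 h4)) h5) (mul_ne_zero two_ne_zero h6))
  · rw [(hkd z₀ hz₀).deriv, hf.map_base]
    have hcb : ‖c‖ = ‖s z₀‖ ^ 2 := by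
      rw [← norm_pow, hsq, hh]
      simp [hf.map_base]
    have hbpos : 0 < ‖s z₀‖ := norm_pos_iff.2 (hs0 z₀ hz₀)
    have hfpos : 0 < ‖deriv f z₀‖ := norm_pos_iff.2 (hf.deriv_ne_zero z₀ hz₀)
    rw [one_sub_conj_mul_self, one_sub_conj_mul_self]
    have hB : 0 < 1 - ‖s z₀‖ ^ 2 := by nlinarith
    have hC : 0 < 1 - ‖c‖ ^ 2 := by nlinarith [norm_nonneg c]
    simp only [norm_mul, norm_div, norm_pow, Complex.norm_real, Real.norm_eq_abs,
      abs_of_pos hB, abs_of_pos hC, mul_zero, sub_zero, one_pow, div_one, Complex.norm_ofNat]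
    rw [hcb]
    have hB' : (1 - ‖s z₀‖ ^ 2) ≠ 0 := hB.ne'
    -- Since |c| = |s(z₀)|², the derivative grows by the factor (1 + b²)/(2b) with b = |s(z₀)| < 1,
    -- which exceeds 1.
    have : (1 - ‖s z₀‖ ^ 2) / (1 - ‖s z₀‖ ^ 2) ^ 2 *
        ((1 - (‖s z₀‖ ^ 2) ^ 2) * ‖deriv f z₀‖ / (2 * ‖s z₀‖)) =
        ‖deriv f z₀‖ * ((1 + ‖s z₀‖ ^ 2) / (2 * ‖s z₀‖)) := by
      field_simp
      ring
    rw [this]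
    refine lt_mul_of_one_lt_right hfpos ?_
    rw [one_lt_div (by positivity)]
    nlinarith [sq_pos_of_pos (sub_pos.2 hb)]

/-- A locally uniform limit of normalized univalent functions is again one, unless its derivative
at the base point vanishes. -/
lemma IsDiscEmbedding.of_tendsto {ι : Type*} {l : Filter ι} [l.NeBot] {U : Set ℂ} (hUo : IsOpen U)
    (hUp : IsPreconnected U) {z₀ : ℂ} (hz₀ : z₀ ∈ U) {F : ι → ℂ → ℂ} {g : ℂ → ℂ}
    (hF : ∀ i, IsDiscEmbedding U z₀ (F i)) (h : TendstoLocallyUniformlyOn F g l U)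
    (hg0 : deriv g z₀ ≠ 0) : IsDiscEmbedding U z₀ g := by
  have hFd : ∀ i, DifferentiableOn ℂ (F i) U := fun i => (hF i).differentiableOn
  have hg : DifferentiableOn ℂ g U := h.differentiableOn (Eventually.of_forall hFd) hUo
  have han := hg.analyticOnNhd hUo
  have hnc : ∀ w ∈ U, ∀ c, ¬ ∀ᶠ z in 𝓝 w, g z = c := by
    intro w hw c hc
    have heq : EqOn g (fun _ => c) U :=
      han.eqOn_of_preconnected_of_eventuallyEq analyticOnNhd_const hUp hw hc
    apply hg0
    rw [(heq.eventuallyEq_of_mem (hUo.mem_nhds hz₀)).deriv_eq, deriv_const]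
  have hle : ∀ z ∈ U, ‖g z‖ ≤ 1 := fun z hz =>
    le_of_tendsto (h.tendsto_at hz).norm
      (Eventually.of_forall fun i => (mem_ball_zero_iff.1 ((hF i).mapsTo hz)).le)
  refine ⟨hg, ?_, ?_, ?_, ?_⟩
  -- The limit only gives |g| ≤ 1; the open mapping theorem makes it strict.
  · rcases han.is_constant_or_isOpen hUp with ⟨c, hc⟩ | hopen
    · exact (hnc z₀ hz₀ c ((hUo.eventually_mem hz₀).mono hc)).elim
    · have h1 : g '' U ⊆ interior (Metric.closedBall 0 1) := by
        refine interior_maximal ?_ (hopen U subset_rfl hUo)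
        rintro _ ⟨z, hz, rfl⟩
        exact mem_closedBall_zero_iff.2 (hle z hz)
      rw [interior_closedBall _ one_ne_zero] at h1
      exact fun z hz => h1 (mem_image_of_mem g hz)
  · intro z hz w hw hzw
    by_contra hne
    have hpos : 0 < dist z w := dist_pos.2 hne
    have hconv : TendstoLocallyUniformlyOn (fun i x => F i x - F i z) (fun x => g x - g z) l U := by
      have h2 : TendstoLocallyUniformlyOn (fun i (_ : ℂ) => F i z) (fun _ => g z) l U := by
        rw [Metric.tendstoLocallyUniformlyOn_iff]
        intro ε hε x _
        refine ⟨univ, univ_mem, ?_⟩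
        filter_upwards [Metric.tendsto_nhds.1 (h.tendsto_at hz) ε hε] with i hi y _
        rwa [dist_comm]
      exact h.sub h2
    -- Hurwitz puts a zero of F i - F i z within half of dist z w of w; injectivity of F i forces it
    -- to be z.
    obtain ⟨i, x, ⟨hx, hxU⟩, hxz⟩ := (hconv.eventually_exists_eq_zero hUo
      (fun i => (hFd i).sub_const _) hw (sub_eq_zero.2 hzw.symm)
      (fun hev => hnc w hw (g z) (hev.mono fun _ => sub_eq_zero.1)) (half_pos hpos)).exists
    have := (hF i).injOn hxU hz (sub_eq_zero.1 hxz)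
    rw [this, Metric.mem_closedBall] at hx
    linarith
  · intro w hw hzero
    obtain ⟨i, x, ⟨-, hxU⟩, hx0⟩ := ((h.deriv (Eventually.of_forall hFd)
      hUo).eventually_exists_eq_zero hUo (fun i => (hFd i).deriv hUo) hw hzero (fun hev => by
        have heq : EqOn (deriv g) 0 U := han.deriv.eqOn_of_preconnected_of_eventuallyEq
          analyticOnNhd_const hUp hw hev
        exact hg0 (heq hz₀)) one_pos).exists
    exact (hF i).deriv_ne_zero x hxU hx0
  · refine tendsto_nhds_unique (h.tendsto_at hz₀) ?_
    simp_rw [(hF _).map_base]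
    exact tendsto_const_nhds

/-- The extremal problem of the Riemann mapping theorem has a solution. -/
lemma exists_isDiscEmbedding_isMax {U : Set ℂ} (hUo : IsOpen U) (hUc : IsSimplyConnected U)
    (hUne : U ≠ univ) {z₀ : ℂ} (hz₀ : z₀ ∈ U) :
    ∃ g, IsDiscEmbedding U z₀ g ∧ ∀ f, IsDiscEmbedding U z₀ f → ‖deriv f z₀‖ ≤ ‖deriv g z₀‖ := by
  obtain ⟨f₀, hf₀⟩ := exists_isDiscEmbedding hUo hUc hUne hz₀
  set S : Set ℝ := (fun f => ‖deriv f z₀‖) '' {f | IsDiscEmbedding U z₀ f}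
  have hS : S.Nonempty := ⟨_, f₀, hf₀, rfl⟩
  obtain ⟨r, hr, hrU⟩ := Metric.isOpen_iff.1 hUo z₀ hz₀
  have hbdd : BddAbove S := by
    refine ⟨1 / r, ?_⟩
    rintro _ ⟨f, hf, rfl⟩
    refine Complex.norm_deriv_le_div_of_mapsTo_ball (hf.differentiableOn.mono hrU) ?_ hr
    rw [hf.map_base]
    exact (hf.mapsTo.mono_left hrU).mono_right Metric.ball_subset_closedBall
  obtain ⟨u, -, hu, huS⟩ := exists_seq_tendsto_sSup hS hbdd
  choose F hF hFu using huS
  obtain ⟨g, hg⟩ := exists_tendstoLocallyUniformlyOn_of_norm_le hUo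
    (fun n => (hF n).differentiableOn)
    (fun n z hz => (mem_ball_zero_iff.1 ((hF n).mapsTo hz)).le) (hyperfilter ℕ)
  have hd : ‖deriv g z₀‖ = sSup S := by
    refine tendsto_nhds_unique (((hg.deriv (Eventually.of_forall
      fun n => (hF n).differentiableOn) hUo).tendsto_at hz₀).norm) ?_
    refine (hu.mono_left Nat.hyperfilter_le_atTop).congr fun n => ?_
    exact (hFu n).symm
  refine ⟨g, IsDiscEmbedding.of_tendsto hUo hUc.isPathConnected.isConnected.isPreconnected hz₀ hF hg
    ?_, fun f hf => hd ▸ le_csSup hbdd ⟨f, hf, rfl⟩⟩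
  rw [← norm_pos_iff, hd]
  exact (norm_pos_iff.2 (hf₀.deriv_ne_zero z₀ hz₀)).trans_le (le_csSup hbdd ⟨f₀, hf₀, rfl⟩)

/-- The Riemann mapping theorem, with a base point. -/
theorem exists_isRiemannMap {U : Set ℂ} (hUo : IsOpen U) (hUc : IsSimplyConnected U)
    (hUne : U ≠ univ) {z₀ : ℂ} (hz₀ : z₀ ∈ U) :
    ∃ φ ψ : ℂ → ℂ, DifferentiableOn ℂ φ U ∧ MapsTo φ U (Metric.ball 0 1) ∧
      DifferentiableOn ℂ ψ (Metric.ball 0 1) ∧ MapsTo ψ (Metric.ball 0 1) U ∧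
      InvOn ψ φ U (Metric.ball 0 1) ∧ φ z₀ = 0 := by
  obtain ⟨g, hg, hmax⟩ := exists_isDiscEmbedding_isMax hUo hUc hUne hz₀
  have hsurj : SurjOn g U (Metric.ball 0 1) := by
    intro c hc
    by_contra hcg
    obtain ⟨k, hk, hlt⟩ := hg.exists_norm_deriv_lt hUo hUc hz₀ (mem_ball_zero_iff.1 hc) hcg
    exact (hmax k hk).not_gt hlt
  have hbij : BijOn g U (Metric.ball 0 1) := ⟨hg.mapsTo, hg.injOn, hsurj⟩
  have hinv := hbij.invOn_invFunOn
  have hmaps : MapsTo (Function.invFunOn g U) (Metric.ball 0 1) U := hsurj.mapsTo_invFunOn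
  refine ⟨g, Function.invFunOn g U, hg.differentiableOn, hg.mapsTo, ?_, hmaps, hinv, hg.map_base⟩
  intro w hw
  have hz := hmaps hw
  set z := Function.invFunOn g U w with hzdef
  have hgz : g z = w := hinv.2 hw
  have hst : HasStrictDerivAt g (deriv g z) z :=
    (hg.differentiableOn.analyticOnNhd hUo z hz).hasStrictDerivAt
  -- A nonzero strict derivative makes g open at z, which is continuity of its inverse at w.
  have hcont : ContinuousAt (Function.invFunOn g U) w := by
    intro N hN
    have h1 : g '' (N ∩ U) ∈ 𝓝 w := by
      rw [← hgz, ← hst.map_nhds_eq (hg.deriv_ne_zero z hz)]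
      exact image_mem_map (inter_mem hN (hUo.mem_nhds hz))
    refine mem_map.2 (mem_of_superset h1 ?_)
    rintro _ ⟨x, ⟨hxN, hxU⟩, rfl⟩
    rw [mem_preimage, hinv.1 hxU]
    exact hxN
  exact (HasDerivAt.of_local_left_inverse hcont hst.hasDerivAt (hg.deriv_ne_zero z hz)
    ((Metric.isOpen_ball.eventually_mem hw).mono
      fun y hy => hinv.2 hy)).differentiableAt.differentiableWithinAt

/-! ### Logarithmic area of annuli and of their univalent images -/

lemma lintegral_annulus_eq {α β : ℝ} (hα : 0 ≤ α) {f : ℂ → ENNReal}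
    (hf : ContinuousOn f {z | α < ‖z‖ ∧ ‖z‖ < β}) :
    ∫⁻ z in {z : ℂ | α < ‖z‖ ∧ ‖z‖ < β}, f z =
      ∫⁻ s in Ioo α β, ∫⁻ θ in Ioo (-Real.pi) Real.pi, ENNReal.ofReal s * f (circleMap 0 s θ) := by
  have hmeas : MeasurableSet {z : ℂ | α < ‖z‖ ∧ ‖z‖ < β} :=
    ((isOpen_lt continuous_const continuous_norm).inter
      (isOpen_lt continuous_norm continuous_const)).measurableSet
  have hset : MeasurableSet (Ioo α β ×ˢ Ioo (-Real.pi) Real.pi) :=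
    measurableSet_Ioo.prod measurableSet_Ioo
  have hcm : Continuous fun p : ℝ × ℝ => circleMap 0 p.1 p.2 := by
    unfold circleMap
    fun_prop
  have hcont : ContinuousOn (fun p : ℝ × ℝ => f (circleMap 0 p.1 p.2))
      (Ioo α β ×ˢ Ioo (-Real.pi) Real.pi) :=
    hf.comp hcm.continuousOn fun p hp => by
      have h0 : 0 ≤ p.1 := hα.trans hp.1.1.le
      simpa [norm_circleMap_zero, abs_of_nonneg h0] using hp.1
  rw [← MeasureTheory.lintegral_indicator hmeas, ← Complex.lintegral_comp_polarCoord_symm]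
  have hcongr : ∀ p ∈ polarCoord.target,
      ENNReal.ofReal p.1 • ({z : ℂ | α < ‖z‖ ∧ ‖z‖ < β}.indicator f (Complex.polarCoord.symm p)) =
      (Ioo α β ×ˢ Ioo (-Real.pi) Real.pi).indicator
        (fun p => ENNReal.ofReal p.1 * f (circleMap 0 p.1 p.2)) p := by
    intro p hp
    obtain ⟨hp1, hp2⟩ := hp
    have h1 : Complex.polarCoord.symm p = circleMap 0 p.1 p.2 := by
      simp [circleMap, Complex.exp_mul_I]
    have h2 : ‖circleMap 0 p.1 p.2‖ = p.1 := by
      rw [norm_circleMap_zero, abs_of_pos hp1]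
    rw [h1]
    by_cases h3 : p.1 ∈ Ioo α β
    · rw [indicator_of_mem (by simpa [h2] using h3), indicator_of_mem (mem_prod.2 ⟨h3, hp2⟩), smul_eq_mul]
    · rw [indicator_of_notMem (fun h => h3 (by simpa [h2] using h)),
        indicator_of_notMem (fun h => h3 h.1), smul_zero]
  rw [MeasureTheory.setLIntegral_congr_fun polarCoord.open_target.measurableSet hcongr,
    MeasureTheory.setLIntegral_indicator hset]
  have hinter : (Ioo α β ×ˢ Ioo (-Real.pi) Real.pi) ∩ polarCoord.target =
      Ioo α β ×ˢ Ioo (-Real.pi) Real.pi := by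
    refine inter_eq_left.2 fun p hp => ⟨hα.trans_lt hp.1.1, hp.2⟩
  rw [hinter, MeasureTheory.Measure.volume_eq_prod, ← MeasureTheory.Measure.prod_restrict,
    MeasureTheory.lintegral_prod]
  rw [MeasureTheory.Measure.prod_restrict, ← MeasureTheory.Measure.volume_eq_prod]
  exact (by fun_prop : Measurable fun p : ℝ × ℝ => ENNReal.ofReal p.1).aemeasurable.mul
    (hcont.aemeasurable hset)

lemma lintegral_Ioo_inv {α β : ℝ} (hα : 0 < α) (hαβ : α ≤ β) :
    ∫⁻ s in Ioo α β, ENNReal.ofReal (2 * Real.pi * s⁻¹) =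
      ENNReal.ofReal (2 * Real.pi * Real.log (β / α)) := by
  have hint : MeasureTheory.IntegrableOn (fun s : ℝ => 2 * Real.pi * s⁻¹) (Ioc α β) := by
    refine (ContinuousOn.integrableOn_Icc ?_).mono_set Ioc_subset_Icc_self
    exact continuousOn_const.mul (continuousOn_inv₀.mono fun s hs => (hα.trans_le hs.1).ne')
  rw [MeasureTheory.setLIntegral_congr MeasureTheory.Ioo_ae_eq_Ioc,
    ← MeasureTheory.ofReal_integral_eq_lintegral_ofReal hint, ← intervalIntegral.integral_of_le hαβ,
    intervalIntegral.integral_const_mul, integral_inv_of_pos hα (hα.trans_le hαβ)]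
  filter_upwards [MeasureTheory.ae_restrict_mem measurableSet_Ioc] with s hs
  have : 0 < s := hα.trans hs.1
  positivity

/-- The mean of m over the circle is m 0 = 1, and |m|² ≥ 2 Re m - 1 pointwise. -/
lemma two_pi_le_lintegral_norm_sq {m : ℂ → ℂ} (hm : DifferentiableOn ℂ m (Metric.ball 0 1))
    (hm0 : m 0 = 1) {s : ℝ} (hs : 0 < s) (hs1 : s < 1) :
    ENNReal.ofReal (2 * Real.pi) ≤
      ∫⁻ θ in Ioo (-Real.pi) Real.pi, ENNReal.ofReal (‖m (circleMap 0 s θ)‖ ^ 2) := by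
  have hball : ∀ θ, circleMap 0 s θ ∈ Metric.ball (0 : ℂ) 1 := fun θ => by
    rw [mem_ball_zero_iff, norm_circleMap_zero, abs_of_pos hs]
    exact hs1
  have hc : Continuous fun θ => m (circleMap 0 s θ) :=
    hm.continuousOn.comp_continuous (continuous_circleMap 0 s) hball
  have hcre : Continuous fun θ => (m (circleMap 0 s θ)).re := Complex.continuous_re.comp hc
  have hcn : Continuous fun θ => ‖m (circleMap 0 s θ)‖ ^ 2 := hc.norm.pow 2
  have hpi : -Real.pi ≤ Real.pi := by linarith [Real.pi_pos]
  have hmean : ∫ θ in (-Real.pi)..Real.pi, m (circleMap 0 s θ) = 2 * Real.pi := by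
    have h1 : Real.circleAverage m 0 s = m 0 := by
      refine DiffContOnCl.circleAverage (DifferentiableOn.diffContOnCl ?_)
      rw [abs_of_pos hs, closure_ball _ hs.ne']
      exact hm.mono (Metric.closedBall_subset_ball hs1)
    have hper : Function.Periodic (fun θ => m (circleMap 0 s θ)) (2 * Real.pi) := fun θ => by
      simp only [periodic_circleMap 0 s θ]
    have h2 := hper.intervalIntegral_add_eq (-Real.pi) 0
    rw [show -Real.pi + 2 * Real.pi = Real.pi by ring, zero_add] at h2
    rw [h2]
    rw [Real.circleAverage_def, hm0, inv_smul_eq_iff₀ (by positivity)] at h1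
    rw [h1]
    simp
  have hre : ∫ θ in (-Real.pi)..Real.pi, (m (circleMap 0 s θ)).re = 2 * Real.pi := by
    have := Complex.reCLM.intervalIntegral_comp_comm
      (hc.intervalIntegrable (μ := MeasureTheory.volume) (-Real.pi) Real.pi)
    simp only [Complex.reCLM_apply] at this
    rw [this, hmean]
    simp
  have hle : 2 * Real.pi ≤ ∫ θ in (-Real.pi)..Real.pi, ‖m (circleMap 0 s θ)‖ ^ 2 := by
    have hlow : Continuous fun θ => 2 * (m (circleMap 0 s θ)).re - 1 :=
      (hcre.const_mul 2).sub continuous_const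
    calc 2 * Real.pi = ∫ θ in (-Real.pi)..Real.pi, (2 * (m (circleMap 0 s θ)).re - 1) := by
          rw [intervalIntegral.integral_sub ((hcre.const_mul 2).intervalIntegrable _ _) (by simp),
            intervalIntegral.integral_const_mul, hre]
          simp
          ring
      _ ≤ _ := by
          refine intervalIntegral.integral_mono_on hpi (hlow.intervalIntegrable _ _) (hcn.intervalIntegrable _ _)
            fun θ _ => ?_
          rw [Complex.sq_norm, Complex.normSq_apply]
          nlinarith [sq_nonneg ((m (circleMap 0 s θ)).re - 1),
            mul_self_nonneg (m (circleMap 0 s θ)).im]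
  rw [MeasureTheory.setLIntegral_congr MeasureTheory.Ioo_ae_eq_Ioc,
    ← MeasureTheory.ofReal_integral_eq_lintegral_ofReal]
  · rw [← intervalIntegral.integral_of_le hpi]
    exact ENNReal.ofReal_le_ofReal hle
  · exact hcn.integrableOn_Icc.mono_set Ioc_subset_Icc_self
  · exact Eventually.of_forall fun θ => by positivity

/-- In polar coordinates s ds dθ against 1/s² leaves ds/s times the circle integral of |m|². In the
application m is z p'/p. -/
lemma le_lintegral_annulus {m : ℂ → ℂ} (hm : DifferentiableOn ℂ m (Metric.ball 0 1))
    (hm0 : m 0 = 1) {r ρ : ℝ} (hr : 0 < r) (hrρ : r ≤ ρ) (hρ : ρ < 1) :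
    ENNReal.ofReal (2 * Real.pi * Real.log (ρ / r)) ≤
      ∫⁻ z in {z : ℂ | r < ‖z‖ ∧ ‖z‖ < ρ}, ENNReal.ofReal (‖m z‖ ^ 2 / ‖z‖ ^ 2) := by
  rw [lintegral_annulus_eq hr.le, ← lintegral_Ioo_inv hr hrρ]
  · refine MeasureTheory.setLIntegral_mono' measurableSet_Ioo fun s hs => ?_
    have hs0 : 0 < s := hr.trans hs.1
    have heq : ∀ θ, ENNReal.ofReal s * ENNReal.ofReal
        (‖m (circleMap 0 s θ)‖ ^ 2 / ‖circleMap 0 s θ‖ ^ 2) =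
        ENNReal.ofReal s⁻¹ * ENNReal.ofReal (‖m (circleMap 0 s θ)‖ ^ 2) := fun θ => by
      rw [← ENNReal.ofReal_mul hs0.le, ← ENNReal.ofReal_mul (inv_nonneg.2 hs0.le),
        norm_circleMap_zero, abs_of_pos hs0]
      congr 1
      field_simp
    simp_rw [heq]
    rw [MeasureTheory.lintegral_const_mul' _ _ ENNReal.ofReal_ne_top, mul_comm (2 * Real.pi),
      ENNReal.ofReal_mul (inv_nonneg.2 hs0.le)]
    gcongr
    exact two_pi_le_lintegral_norm_sq hm hm0 hs0 (hs.2.trans hρ)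
  · refine ENNReal.continuous_ofReal.comp_continuousOn (ContinuousOn.div ?_ (by fun_prop) ?_)
    · refine (hm.continuousOn.mono fun z hz => ?_).norm.pow 2
      exact mem_ball_zero_iff.2 (hz.2.trans hρ)
    · intro z hz
      have := hr.trans hz.1
      positivity

/-- The case m = 1, with equality; it measures the annulus that contains both images. -/
lemma lintegral_annulus_inv_sq {α β : ℝ} (hα : 0 < α) (hαβ : α ≤ β) :
    ∫⁻ z in {z : ℂ | α < ‖z‖ ∧ ‖z‖ < β}, ENNReal.ofReal (1 / ‖z‖ ^ 2) =
      ENNReal.ofReal (2 * Real.pi * Real.log (β / α)) := by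
  rw [lintegral_annulus_eq hα.le, ← lintegral_Ioo_inv hα hαβ]
  · refine MeasureTheory.setLIntegral_congr_fun measurableSet_Ioo fun s hs => ?_
    have hs0 : 0 < s := hα.trans hs.1
    simp only [norm_circleMap_zero, abs_of_pos hs0, ← ENNReal.ofReal_mul hs0.le]
    rw [MeasureTheory.setLIntegral_const, Real.volume_Ioo, ← ENNReal.ofReal_mul (by positivity)]
    congr 1
    field_simp
    ring
  · refine ENNReal.continuous_ofReal.comp_continuousOn (ContinuousOn.div ?_ (by fun_prop) ?_)
    · fun_prop
    · intro z hz
      have := hα.trans hz.1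
      positivity

lemma det_smul_one_complex (c : ℂ) : (c • (1 : ℂ →L[ℝ] ℂ)).det = ‖c‖ ^ 2 := by
  have h : ((c • (1 : ℂ →L[ℝ] ℂ) : ℂ →L[ℝ] ℂ) : ℂ →ₗ[ℝ] ℂ) = Algebra.lmul ℝ ℂ c := by
    ext
    simp
  rw [ContinuousLinearMap.det, h, ← Algebra.norm_apply, Algebra.norm_complex_apply,
    Complex.normSq_eq_norm_sq]

/-- The logarithmic area of a univalent image of an annulus. -/
lemma le_lintegral_image_annulus {m : ℂ → ℂ} (hm : DifferentiableOn ℂ m (Metric.ball 0 1))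
    (hm0 : m 0 = 1) {r ρ : ℝ} (hr : 0 < r) (hrρ : r ≤ ρ) (hρ : ρ < 1) {u u' : ℂ → ℂ}
    (hu : ∀ z, r < ‖z‖ ∧ ‖z‖ < ρ → HasDerivAt u (u' z) z)
    (hinj : InjOn u {z : ℂ | r < ‖z‖ ∧ ‖z‖ < ρ})
    (hum : ∀ z, r < ‖z‖ ∧ ‖z‖ < ρ → ‖u' z‖ ^ 2 * (1 / ‖u z‖ ^ 2) = ‖m z‖ ^ 2 / ‖z‖ ^ 2) :
    MeasurableSet (u '' {z : ℂ | r < ‖z‖ ∧ ‖z‖ < ρ}) ∧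
    ENNReal.ofReal (2 * Real.pi * Real.log (ρ / r)) ≤
      ∫⁻ w in u '' {z : ℂ | r < ‖z‖ ∧ ‖z‖ < ρ}, ENNReal.ofReal (1 / ‖w‖ ^ 2) := by
  have hmeas : MeasurableSet {z : ℂ | r < ‖z‖ ∧ ‖z‖ < ρ} :=
    ((isOpen_lt continuous_const continuous_norm).inter
      (isOpen_lt continuous_norm continuous_const)).measurableSet
  have hder : ∀ z ∈ {z : ℂ | r < ‖z‖ ∧ ‖z‖ < ρ},
      HasFDerivWithinAt u (u' z • (1 : ℂ →L[ℝ] ℂ)) {z : ℂ | r < ‖z‖ ∧ ‖z‖ < ρ} z :=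
    fun z hz => (hu z hz).complexToReal_fderiv.hasFDerivWithinAt
  refine ⟨MeasureTheory.measurable_image_of_fderivWithin hmeas hder hinj, ?_⟩
  rw [MeasureTheory.lintegral_image_eq_lintegral_abs_det_fderiv_mul _ hmeas hder hinj]
  refine (le_lintegral_annulus hm hm0 hr hrρ hρ).trans_eq
    (MeasureTheory.setLIntegral_congr_fun hmeas fun z hz => ?_)
  rw [det_smul_one_complex, abs_of_nonneg (by positivity), ← ENNReal.ofReal_mul (by positivity),
    hum z hz]

/-! ### Bieberbach–Eilenberg functions and the Koebe one-quarter theorem -/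

/-- Univalent Bieberbach–Eilenberg functions have derivative at most `1` at the origin. -/
theorem norm_deriv_le_one_of_mul_ne_one {p : ℂ → ℂ} (hp : DifferentiableOn ℂ p (Metric.ball 0 1))
    (hinj : InjOn p (Metric.ball 0 1)) (hp0 : p 0 = 0)
    (hmul : ∀ z ∈ Metric.ball (0 : ℂ) 1, ∀ w ∈ Metric.ball (0 : ℂ) 1, p z * p w ≠ 1) :
    ‖deriv p 0‖ ≤ 1 := by
  by_contra! ha
  have h0 : (0 : ℂ) ∈ Metric.ball (0 : ℂ) 1 := Metric.mem_ball_self one_pos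
  set Q := dslope p 0 with hQ
  have hQd : DifferentiableOn ℂ Q (Metric.ball 0 1) :=
    (Complex.differentiableOn_dslope (Metric.ball_mem_nhds 0 one_pos)).2 hp
  have hpQ : ∀ z, p z = z * Q z := fun z => by
    have := sub_smul_dslope p 0 z
    rw [hp0, sub_zero, sub_zero, smul_eq_mul] at this
    exact this.symm
  have hQ0 : Q 0 = deriv p 0 := dslope_same p 0
  have hQne : ∀ z ∈ Metric.ball (0 : ℂ) 1, Q z ≠ 0 := by
    intro z hz h
    have hpz : p z = p 0 := by rw [hpQ, h, mul_zero, hp0]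
    have := hinj hz h0 hpz
    rw [this, hQ0] at h
    rw [h, norm_zero] at ha
    linarith
  -- With 1 < b < |p'(0)| and 1/b < ρ < 1, the area comparison will give the contradiction ρ ≤ 1/b.
  obtain ⟨b, hb1, hba⟩ := exists_between ha
  obtain ⟨ρ, hbρ, hρ1⟩ := exists_between (inv_lt_one_of_one_lt₀ hb1)
  have hb : 0 < b := one_pos.trans hb1
  have hρ : 0 < ρ := (inv_pos.2 hb).trans hbρ
  have hsub : Metric.closedBall (0 : ℂ) ρ ⊆ Metric.ball 0 1 := Metric.closedBall_subset_ball hρ1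
  obtain ⟨x, hx, hmin⟩ := (isCompact_closedBall (0 : ℂ) ρ).exists_isMinOn
    ⟨0, Metric.mem_closedBall_self hρ.le⟩ (hQd.continuousOn.norm.mono hsub)
  obtain ⟨y, hy, hmax⟩ := (isCompact_closedBall (0 : ℂ) ρ).exists_isMaxOn
    ⟨0, Metric.mem_closedBall_self hρ.le⟩ (hp.continuousOn.norm.mono hsub)
  have hκ : 0 < ‖Q x‖ := norm_pos_iff.2 (hQne x (hsub hx))
  obtain ⟨δ, hδ, hδb⟩ : ∃ δ > 0, ∀ z, ‖z‖ < δ → b < ‖Q z‖ := by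
    have hcont : ContinuousAt (fun z => ‖Q z‖) 0 :=
      (hQd.continuousOn.continuousAt (Metric.ball_mem_nhds 0 one_pos)).norm
    have hev : ∀ᶠ z in 𝓝 (0 : ℂ), b < ‖Q z‖ :=
      hcont.eventually (lt_mem_nhds (by simpa [hQ0] using hba))
    obtain ⟨δ, hδ, h⟩ := Metric.eventually_nhds_iff_ball.1 hev
    exact ⟨δ, hδ, fun z hz => h z (mem_ball_zero_iff.2 hz)⟩
  -- For small r, p maps r < |z| < ρ into br < |w| < 1/(br): within δ of 0 use |p| > b|z|, beyond it
  -- the positive minimum of |Q|. This annulus is invariant under inversion.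
  obtain ⟨r, hr, hrρ, hrc, hrM⟩ : ∃ r > 0, r < ρ ∧ b * r < δ * ‖Q x‖ ∧ b * r * ‖p y‖ < 1 := by
    have hev : ∀ᶠ r in 𝓝[>] (0 : ℝ), r < ρ ∧ b * r < δ * ‖Q x‖ ∧ b * r * ‖p y‖ < 1 := by
      refine Filter.Eventually.filter_mono nhdsWithin_le_nhds ?_
      refine (eventually_lt_nhds hρ).and (Filter.Eventually.and ?_ ?_)
      · refine (by fun_prop : Continuous fun r => b * r).continuousAt.eventually
          (gt_mem_nhds ?_)
        simpa using by positivity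
      · refine (by fun_prop : Continuous fun r => b * r * ‖p y‖).continuousAt.eventually
          (gt_mem_nhds ?_)
        simp
    obtain ⟨r, h1, h2⟩ := (hev.and self_mem_nhdsWithin).exists
    exact ⟨r, h2, h1⟩
  have hbr : 0 < b * r := mul_pos hb hr
  set A : Set ℂ := {z | r < ‖z‖ ∧ ‖z‖ < ρ} with hA
  have hAball : A ⊆ Metric.ball 0 1 := fun z hz => mem_ball_zero_iff.2 (hz.2.trans hρ1)
  have hlow : ∀ z ∈ A, b * r < ‖p z‖ := by
    intro z hz
    rw [hpQ, norm_mul]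
    rcases lt_or_ge ‖z‖ δ with h | h
    · have := hδb z h
      nlinarith [hz.1]
    · have h2 : ‖Q x‖ ≤ ‖Q z‖ := hmin (mem_closedBall_zero_iff.2 hz.2.le)
      exact hrc.trans_le (mul_le_mul h h2 hκ.le (norm_nonneg _))
  have hup : ∀ z ∈ A, ‖p z‖ < (b * r)⁻¹ := by
    intro z hz
    have h2 : ‖p z‖ ≤ ‖p y‖ := hmax (mem_closedBall_zero_iff.2 hz.2.le)
    rw [← one_div, lt_div_iff₀ hbr]
    nlinarith
  have hne : ∀ z ∈ A, p z ≠ 0 := fun z hz => norm_pos_iff.1 (hbr.trans (hlow z hz))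
  have hz0 : ∀ z ∈ A, z ≠ 0 := fun z hz => norm_pos_iff.1 (hr.trans hz.1)
  have hder : ∀ z ∈ A, HasDerivAt p (deriv p z) z := fun z hz =>
    (hp.differentiableAt (Metric.isOpen_ball.mem_nhds (hAball hz))).hasDerivAt
  -- This is z p'/p with the singularity at 0 removed; up to sign, 1/p has the same logarithmic
  -- derivative.
  set m : ℂ → ℂ := fun z => deriv p z / Q z with hm
  have hmd : DifferentiableOn ℂ m (Metric.ball 0 1) :=
    (hp.deriv Metric.isOpen_ball).div hQd hQne
  have hm0 : m 0 = 1 := by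
    rw [hm]
    simp only
    rw [← hQ0, div_self (hQne 0 h0)]
  obtain ⟨hM1, hI1⟩ := le_lintegral_image_annulus hmd hm0 hr hrρ.le hρ1 hder (hinj.mono hAball) (by
    intro z hz
    have h1 := norm_pos_iff.2 (hz0 z hz)
    have h2 := norm_pos_iff.2 (hQne z (hAball hz))
    simp only [hm, hpQ z, norm_mul, norm_div]
    field_simp)
  obtain ⟨hM2, hI2⟩ := le_lintegral_image_annulus hmd hm0 hr hrρ.le hρ1
    (u := fun z => (p z)⁻¹) (fun z hz => (hder z hz).inv (hne z hz))
    (fun z hz w hw h => hinj (hAball hz) (hAball hw) (inv_injective h)) (by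
    intro z hz
    have h1 := norm_pos_iff.2 (hz0 z hz)
    have h2 := norm_pos_iff.2 (hQne z (hAball hz))
    simp only [hm, hpQ z, norm_mul, norm_div, norm_neg, norm_inv, norm_pow]
    field_simp)
  have hdisj : Disjoint (p '' A) ((fun z => (p z)⁻¹) '' A) := by
    rw [Set.disjoint_left]
    rintro _ ⟨z, hz, rfl⟩ ⟨w, hw, h⟩
    refine hmul z (hAball hz) w (hAball hw) ?_
    rw [← h]
    exact inv_mul_cancel₀ (hne w hw)
  have hunion : p '' A ∪ (fun z => (p z)⁻¹) '' A ⊆ {w | b * r < ‖w‖ ∧ ‖w‖ < (b * r)⁻¹} := by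
    rintro _ (⟨z, hz, rfl⟩ | ⟨z, hz, rfl⟩)
    · exact ⟨hlow z hz, hup z hz⟩
    · simp only [mem_ofPred_eq, norm_inv]
      exact ⟨(lt_inv_comm₀ hbr (hbr.trans (hlow z hz))).2 (hup z hz),
        (inv_lt_inv₀ (hbr.trans (hlow z hz)) hbr).2 (hlow z hz)⟩
  have hbr1 : b * r ≤ (b * r)⁻¹ := by
    obtain ⟨t, ht1, ht2⟩ := exists_between hrρ
    have htA : (t : ℂ) ∈ A := by
      simp only [hA, mem_ofPred_eq, Complex.norm_real, Real.norm_of_nonneg (hr.trans ht1).le]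
      exact ⟨ht1, ht2⟩
    exact ((hlow _ htA).trans (hup _ htA)).le
  have hfin := MeasureTheory.lintegral_mono_set (μ := MeasureTheory.volume)
    (f := fun w : ℂ => ENNReal.ofReal (1 / ‖w‖ ^ 2)) hunion
  rw [MeasureTheory.lintegral_union hM2 hdisj, lintegral_annulus_inv_sq hbr hbr1] at hfin
  have hfin' := (add_le_add hI1 hI2).trans hfin
  have hρr : 1 ≤ ρ / r := (one_le_div hr).2 hrρ.le
  have hlog : 0 ≤ 2 * Real.pi * Real.log (ρ / r) :=
    mul_nonneg (by positivity) (Real.log_nonneg hρr)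
  have hlog' : 0 ≤ Real.log ((b * r)⁻¹ / (b * r)) :=
    Real.log_nonneg ((one_le_div hbr).2 hbr1)
  rw [← ENNReal.ofReal_add hlog hlog,
    ENNReal.ofReal_le_ofReal_iff (mul_nonneg (by positivity) hlog')] at hfin'
  have hpi := Real.pi_pos
  -- The factor 2 from the two images cancels that from log (br)⁻².
  have hcmp : Real.log (ρ / r) ≤ Real.log (b * r)⁻¹ := by
    have : (b * r)⁻¹ / (b * r) = (b * r)⁻¹ ^ 2 := by
      rw [div_eq_mul_inv, sq]
    rw [this, Real.log_pow] at hfin'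
    push_cast at hfin'
    have : 2 * Real.pi * Real.log (ρ / r) ≤ 2 * Real.pi * Real.log (b * r)⁻¹ := by linarith
    exact le_of_mul_le_mul_left this (by positivity)
  have hle := (Real.log_le_log_iff (by positivity) (by positivity)).1 hcmp
  have h1 : ρ ≤ b⁻¹ := by
    calc ρ = ρ / r * r := by field_simp
      _ ≤ (b * r)⁻¹ * r := mul_le_mul_of_nonneg_right hle hr.le
      _ = b⁻¹ := by field_simp
  linarith

lemma deriv_mul_deriv_eq_one_of_leftInvOn {U : Set ℂ} (hUo : IsOpen U) {φ ψ : ℂ → ℂ}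
    (hinv : LeftInvOn ψ φ U) {z : ℂ} (hz : z ∈ U) (hφ : DifferentiableAt ℂ φ z)
    (hψ : DifferentiableAt ℂ ψ (φ z)) : deriv ψ (φ z) * deriv φ z = 1 := by
  refine (hψ.hasDerivAt.comp z hφ.hasDerivAt).unique
    ((hasDerivAt_id z).congr_of_eventuallyEq ?_)
  filter_upwards [hUo.mem_nhds hz] with w hw using hinv hw

/-- The Koebe one-quarter theorem for holomorphic maps of the disc into simply connected domains. -/
theorem norm_deriv_le_four_mul_norm_sub {V : Set ℂ} (hVo : IsOpen V) (hVc : IsSimplyConnected V)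
    {f : ℂ → ℂ} (hf : DifferentiableOn ℂ f (Metric.ball 0 1)) (hfm : MapsTo f (Metric.ball 0 1) V)
    {a : ℂ} (ha : a ∉ V) : ‖deriv f 0‖ ≤ 4 * ‖f 0 - a‖ := by
  have h0 : (0 : ℂ) ∈ Metric.ball (0 : ℂ) 1 := Metric.mem_ball_self one_pos
  have hf0 : f 0 ∈ V := hfm h0
  obtain ⟨φ, ψ, hφd, hφm, hψd, hψm, hinv, hφ0⟩ := exists_isRiemannMap hVo hVc
    ((ne_univ_iff_exists_notMem V).2 ⟨a, ha⟩) hf0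
  obtain ⟨q, hqd, hqi, hq0, hq1, -, hq'⟩ := exists_injOn_mul_ne_one hVo hVc ha hf0
  have hψ0 : ψ 0 = f 0 := by simpa only [hφ0] using hinv.1 hf0
  have hφ' := hφd.differentiableAt (hVo.mem_nhds hf0)
  have hψ' := hψd.differentiableAt (Metric.isOpen_ball.mem_nhds h0)
  have hf' := hf.differentiableAt (Metric.isOpen_ball.mem_nhds h0)
  have hone : deriv ψ 0 * deriv φ (f 0) = 1 := by
    have := deriv_mul_deriv_eq_one_of_leftInvOn hVo hinv.1 hf0 hφ' (by rwa [hφ0])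
    rwa [hφ0] at this
  -- Schwarz's lemma for φ ∘ f reduces the bound to the univalent map ψ.
  have hschwarz : ‖deriv φ (f 0) * deriv f 0‖ ≤ 1 := by
    rw [← (hφ'.hasDerivAt.comp 0 hf'.hasDerivAt).deriv]
    refine Complex.norm_deriv_le_one_of_mapsTo_ball (hφd.comp hf hfm) ?_ one_pos
    rw [Function.comp_apply, hφ0]
    exact (hφm.comp hfm).mono_right Metric.ball_subset_closedBall
  have hp : ‖1 / (4 * (f 0 - a)) * deriv ψ 0‖ ≤ 1 := by
    have hq'' : HasDerivAt q (1 / (4 * (f 0 - a))) (ψ 0) := by rwa [hψ0]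
    rw [← (hq''.comp 0 hψ'.hasDerivAt).deriv]
    exact norm_deriv_le_one_of_mul_ne_one (hqd.comp hψd hψm)
      (hqi.comp hinv.2.injOn hψm) (by rw [Function.comp_apply, hψ0, hq0])
      fun z hz w hw => hq1 _ (hψm hz) _ (hψm hw)
  have hpos : 0 < ‖f 0 - a‖ := norm_pos_iff.2 (sub_ne_zero.2 (ne_of_mem_of_not_mem hf0 ha))
  rw [norm_mul, norm_div, norm_one, norm_mul, Complex.norm_ofNat, one_div_mul_eq_div,
    div_le_one (by positivity)] at hp
  calc ‖deriv f 0‖ = ‖deriv ψ 0‖ * ‖deriv φ (f 0) * deriv f 0‖ := by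
        rw [← norm_mul, ← mul_assoc, hone, one_mul]
    _ ≤ ‖deriv ψ 0‖ * 1 := by gcongr
    _ ≤ 4 * ‖f 0 - a‖ := by rwa [mul_one]

/-! ### The hyperbolic density and the derivative bound -/

/-- The comparison of the hyperbolic density of `U` with the distance to the boundary of a simply
connected domain containing the values of a holomorphic map on `U`. -/
lemma norm_deriv_le_hyperbolicDensity_mul_infDist {U V : Set ℂ} (hUo : IsOpen U)
    (hUc : IsSimplyConnected U) (hUne : U ≠ univ) (hVo : IsOpen V) (hVc : IsSimplyConnected V)
    (hVne : V ≠ univ) {F : ℂ → ℂ} (hF : DifferentiableOn ℂ F U) (hFm : MapsTo F U V) {z : ℂ}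
    (hz : z ∈ U) :
    ‖deriv F z‖ ≤ 2 * hyperbolicDensity U z * Metric.infDist (F z) (frontier V) := by
  -- A nearest boundary point exists because the frontier is nonempty, and it is omitted because V
  -- is open.
  obtain ⟨a, ha, hda⟩ := (isClosed_frontier (s := V)).exists_infDist_eq_dist
    (nonempty_frontier_iff.2 ⟨hVc.nonempty, hVne⟩) (F z)
  rw [hVo.frontier_eq] at ha
  obtain ⟨φ, ψ, hφd, hφm, hψd, hψm, hinv, hφ0⟩ := exists_isRiemannMap hUo hUc hUne hz
  have h0 : (0 : ℂ) ∈ Metric.ball (0 : ℂ) 1 := Metric.mem_ball_self one_pos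
  have hψ0 : ψ 0 = z := by rw [← hφ0]; exact hinv.1 hz
  have hψ' := hψd.differentiableAt (Metric.isOpen_ball.mem_nhds h0)
  have hone : deriv ψ 0 * deriv φ z = 1 := by
    have := deriv_mul_deriv_eq_one_of_leftInvOn hUo hinv.1 hz
      (hφd.differentiableAt (hUo.mem_nhds hz)) (by rwa [hφ0])
    rwa [hφ0] at this
  have hF' : HasDerivAt F (deriv F z) (ψ 0) := by
    rw [hψ0]
    exact (hF.differentiableAt (hUo.mem_nhds hz)).hasDerivAt
  have hkoebe := norm_deriv_le_four_mul_norm_sub hVo hVc (hF.comp hψd hψm) (hFm.comp hψm) ha.2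
  rw [(hF'.comp 0 hψ'.hasDerivAt).deriv, Function.comp_apply, hψ0, ← dist_eq_norm, ← hda] at hkoebe
  -- As φ z = 0, the density at z is 2|φ'(z)|, so Koebe's 4 becomes 2.
  rw [hyperbolicDensity_eq hUo ⟨hφd, hφm, ψ, hψd, hψm, hinv⟩ hz, hφ0]
  calc ‖deriv F z‖ = ‖deriv F z * deriv ψ 0‖ * ‖deriv φ z‖ := by
        rw [← norm_mul, mul_assoc, hone, mul_one]
    _ ≤ 4 * Metric.infDist (F z) (frontier V) * ‖deriv φ z‖ := by gcongr
    _ = _ := by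
      rw [norm_zero]
      ring

lemma hyperbolicDensity_nonneg {U : Set ℂ} (hUo : IsOpen U) {φ : ℂ → ℂ} (hφ : IsRiemannMap U φ)
    {z : ℂ} (hz : z ∈ U) : 0 ≤ hyperbolicDensity U z := by
  have h1 : ‖φ z‖ < 1 := mem_ball_zero_iff.1 (hφ.2.1 hz)
  rw [hyperbolicDensity_eq hUo hφ hz]
  exact div_nonneg (by positivity) (by nlinarith [norm_nonneg (φ z)])

lemma continuousOn_hyperbolicDensity {U : Set ℂ} (hUo : IsOpen U) {φ : ℂ → ℂ}
    (hφ : IsRiemannMap U φ) : ContinuousOn (hyperbolicDensity U) U := by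
  refine ContinuousOn.congr (f := fun z => 2 * ‖deriv φ z‖ / (1 - ‖φ z‖ ^ 2)) ?_
    fun z hz => hyperbolicDensity_eq hUo hφ hz
  refine ContinuousOn.div (continuousOn_const.mul (hφ.1.deriv hUo).continuousOn.norm)
    (continuousOn_const.sub (hφ.1.continuousOn.norm.pow 2)) fun z hz => ?_
  have h1 : ‖φ z‖ < 1 := mem_ball_zero_iff.1 (hφ.2.1 hz)
  nlinarith [norm_nonneg (φ z)]

/-! ### Growth along curves and the main estimate -/

/-- A Grönwall inequality on `[0, 1]`, run backwards from the endpoint `1`. -/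
lemma add_integral_le_mul_exp {g h : ℝ → ℝ} (hg : ContinuousOn g (Icc 0 1))
    (hh : ContinuousOn h (Icc 0 1)) {δ : ℝ}
    (hle : ∀ t ∈ Ioo (0 : ℝ) 1, h t ≤ 2 * g t * (δ + ∫ s in t..1, h s)) :
    δ + ∫ s in (0 : ℝ)..1, h s ≤ δ * Real.exp (2 * ∫ s in (0 : ℝ)..1, g s) := by
  have hprim : ∀ {k : ℝ → ℝ}, ContinuousOn k (Icc 0 1) →
      ContinuousOn (fun t => ∫ s in t..1, k s) (Icc 0 1) ∧
      ∀ t ∈ Ioo (0 : ℝ) 1, HasDerivAt (fun t => ∫ s in t..1, k s) (-k t) t := by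
    intro k hk
    refine ⟨?_, fun t ht => ?_⟩
    · have := intervalIntegral.continuousOn_primitive_interval_left (μ := MeasureTheory.volume)
        (f := k) (a := 0) (b := 1) (by rw [uIcc_of_le zero_le_one]; exact hk.integrableOn_Icc)
      rwa [uIcc_of_le zero_le_one] at this
    · refine intervalIntegral.integral_hasDerivAt_left ?_ ?_ ?_
      · refine ContinuousOn.intervalIntegrable ?_
        rw [uIcc_of_le ht.2.le]
        exact hk.mono (Icc_subset_Icc_left ht.1.le)
      · exact (hk.mono Ioo_subset_Icc_self).stronglyMeasurableAtFilter isOpen_Ioo t ht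
      · exact hk.continuousAt (Icc_mem_nhds ht.1 ht.2)
  obtain ⟨hgc, hgd⟩ := hprim hg
  obtain ⟨hhc, hhd⟩ := hprim hh
  -- The integrating factor makes `hle` say exactly that E' ≥ 0; compare E 0 with E 1 = δ.
  set E : ℝ → ℝ := fun t => (δ + ∫ s in t..1, h s) * Real.exp (-2 * ∫ s in t..1, g s) with hE
  have hmono : MonotoneOn E (Icc 0 1) := by
    refine monotoneOn_of_hasDerivWithinAt_nonneg (convex_Icc 0 1)
      (f' := fun t => (-h t) * Real.exp (-2 * ∫ s in t..1, g s) +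
        (δ + ∫ s in t..1, h s) * (Real.exp (-2 * ∫ s in t..1, g s) * (-2 * -g t)))
      ((continuousOn_const.add hhc).mul (continuousOn_const.mul hgc).rexp) ?_ ?_
    · intro t ht
      rw [interior_Icc] at ht
      exact (((hhd t ht).const_add δ).mul ((hgd t ht).const_mul (-2)).exp).hasDerivWithinAt
    · intro t ht
      rw [interior_Icc] at ht
      have h1 := mul_nonneg (sub_nonneg.2 (hle t ht))
        (Real.exp_pos (-2 * ∫ s in t..1, g s)).le
      nlinarith
  have h01 := hmono (left_mem_Icc.2 zero_le_one) (right_mem_Icc.2 zero_le_one) zero_le_one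
  simp only [hE, intervalIntegral.integral_same, mul_zero, Real.exp_zero, add_zero, mul_one] at h01
  rw [neg_mul, Real.exp_neg, ← div_eq_mul_inv, div_le_iff₀ (Real.exp_pos _)] at h01
  exact h01

/-- The growth estimate along a curve. -/
lemma norm_sub_le_of_curve {U V : Set ℂ} (hUo : IsOpen U) (hUc : IsSimplyConnected U)
    (hUne : U ≠ univ) (hVo : IsOpen V) (hVc : IsSimplyConnected V) (hVne : V ≠ univ) {F : ℂ → ℂ}
    (hF : DifferentiableOn ℂ F U) (hFm : MapsTo F U V) {γ : ℝ → ℂ}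
    (hγ : ContDiffOn ℝ 1 γ (Icc 0 1)) (hγm : MapsTo γ (Icc 0 1) U) :
    ‖F (γ 0) - F (γ 1)‖ ≤ 2 * hyperbolicLength U γ * Real.exp (2 * hyperbolicLength U γ) *
      Metric.infDist (F (γ 1)) (frontier V) := by
  obtain ⟨φ, ψ, hφd, hφm, hψd, hψm, hinv, -⟩ := exists_isRiemannMap hUo hUc hUne
    (hγm (left_mem_Icc.2 zero_le_one))
  have hφ : IsRiemannMap U φ := ⟨hφd, hφm, ψ, hψd, hψm, hinv⟩
  set δ := Metric.infDist (F (γ 1)) (frontier V) with hδ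
  have hγ' : ContinuousOn (derivWithin γ (Icc 0 1)) (Icc 0 1) :=
    hγ.continuousOn_derivWithin (uniqueDiffOn_Icc zero_lt_one) le_rfl
  set c : ℝ → ℂ := fun t => deriv F (γ t) * derivWithin γ (Icc 0 1) t with hc
  have hcc : ContinuousOn c (Icc 0 1) :=
    ((hF.deriv hUo).continuousOn.comp hγ.continuousOn hγm).mul hγ'
  have hgc : ContinuousOn (fun t => hyperbolicDensity U (γ t) * ‖derivWithin γ (Icc 0 1) t‖)
      (Icc 0 1) :=
    ((continuousOn_hyperbolicDensity hUo hφ).comp hγ.continuousOn hγm).mul hγ'.norm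
  have hder : ∀ t ∈ Ioo (0 : ℝ) 1, HasDerivAt (fun t => F (γ t)) (c t) t := by
    intro t ht
    have htI := Ioo_subset_Icc_self ht
    have h1 : HasDerivAt γ (derivWithin γ (Icc 0 1) t) t :=
      ((hγ.differentiableOn one_ne_zero t htI).hasDerivWithinAt).hasDerivAt
        (Icc_mem_nhds ht.1 ht.2)
    exact (hF.differentiableAt (hUo.mem_nhds (hγm htI))).hasDerivAt.comp_of_eq t h1 rfl
  have hbound : ∀ t ∈ Icc (0 : ℝ) 1, ‖F (γ t) - F (γ 1)‖ ≤ ∫ s in t..1, ‖c s‖ := by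
    intro t ht
    have hsub : Icc t 1 ⊆ Icc (0 : ℝ) 1 := Icc_subset_Icc_left ht.1
    have h1 : ∫ s in t..1, c s = F (γ 1) - F (γ t) :=
      intervalIntegral.integral_eq_sub_of_hasDerivAt_of_le ht.2
        ((hF.continuousOn.comp hγ.continuousOn hγm).mono hsub)
        (fun s hs => hder s ⟨ht.1.trans_lt hs.1, hs.2⟩)
        (ContinuousOn.intervalIntegrable (by rw [uIcc_of_le ht.2]; exact hcc.mono hsub))
    rw [norm_sub_rev, ← h1]
    exact intervalIntegral.norm_integral_le_integral_norm ht.2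
  have hgron := add_integral_le_mul_exp hgc hcc.norm (δ := δ) fun t ht => by
    have htI := Ioo_subset_Icc_self ht
    have h1 := norm_deriv_le_hyperbolicDensity_mul_infDist hUo hUc hUne hVo hVc hVne hF hFm
      (hγm htI)
    -- Distance to the frontier is 1-Lipschitz, so the derivative bound closes into an integral
    -- inequality for |c|.
    have h2 : Metric.infDist (F (γ t)) (frontier V) ≤ δ + ∫ s in t..1, ‖c s‖ := by
      refine (Metric.infDist_le_infDist_add_dist (y := F (γ 1))).trans ?_
      rw [dist_eq_norm]
      gcongr
      exact hbound t htI
    have h3 := hyperbolicDensity_nonneg hUo hφ (hγm htI)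
    calc ‖c t‖ = ‖deriv F (γ t)‖ * ‖derivWithin γ (Icc 0 1) t‖ := norm_mul _ _
      _ ≤ 2 * hyperbolicDensity U (γ t) * (δ + ∫ s in t..1, ‖c s‖) *
          ‖derivWithin γ (Icc 0 1) t‖ := by
        gcongr
        exact h1.trans (by gcongr)
      _ = _ := by ring
  change δ + _ ≤ δ * Real.exp (2 * hyperbolicLength U γ) at hgron
  have hδ0 : 0 ≤ δ := Metric.infDist_nonneg
  set x := 2 * hyperbolicLength U γ
  -- This is 1 - x ≤ e^{-x} multiplied by e^x.
  have hexp : Real.exp x - 1 ≤ x * Real.exp x := by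
    have h1 := mul_le_mul_of_nonneg_right (Real.add_one_le_exp (-x)) (Real.exp_pos x).le
    rw [← Real.exp_add, neg_add_cancel, Real.exp_zero] at h1
    linarith
  have h1 := mul_le_mul_of_nonneg_right hexp hδ0
  have h2 := hbound 0 (left_mem_Icc.2 zero_le_one)
  linarith

/-- The preimage of a segment in the disc. It keeps the infimum defining the distance from being
that of the empty set, whose value is 0 by convention. -/
lemma IsRiemannMap.exists_contDiffOn_curve {U : Set ℂ} {φ : ℂ → ℂ} (hφ : IsRiemannMap U φ) {z w : ℂ}
    (hz : z ∈ U) (hw : w ∈ U) :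
    ∃ γ : ℝ → ℂ, ContDiffOn ℝ 1 γ (Icc 0 1) ∧ MapsTo γ (Icc 0 1) U ∧ γ 0 = z ∧ γ 1 = w := by
  obtain ⟨-, hφm, ψ, hψd, hψm, hinv⟩ := hφ
  set σ : ℝ → ℂ := fun t => AffineMap.lineMap (φ z) (φ w) t with hσ
  have hσm : MapsTo σ (Icc 0 1) (Metric.ball 0 1) := fun t ht =>
    (convex_ball (0 : ℂ) 1 : Convex ℝ _).lineMap_mem (hφm hz) (hφm hw) ht
  have hσc : ContDiff ℝ 1 σ := by
    have : σ = fun t : ℝ => t • (φ w - φ z) + φ z := by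
      ext t
      simp [hσ, AffineMap.lineMap_apply]
    rw [this]
    fun_prop
  refine ⟨ψ ∘ σ, ?_, hψm.comp hσm, ?_, ?_⟩
  · have h1 : ContDiffOn ℂ 1 ψ (Metric.ball 0 1) := hψd.contDiffOn Metric.isOpen_ball
    exact (h1.restrict_scalars ℝ).comp hσc.contDiffOn hσm
  · simp [hσ, hinv.1 hz]
  · simp [hσ, hinv.1 hw]

/-- The growth estimate for holomorphic maps between simply connected domains. -/
theorem norm_sub_le_hyperbolicDist {U V : Set ℂ} (hUo : IsOpen U) (hUc : IsSimplyConnected U)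
    (hUne : U ≠ univ) (hVo : IsOpen V) (hVc : IsSimplyConnected V) (hVne : V ≠ univ) {F : ℂ → ℂ}
    (hF : DifferentiableOn ℂ F U) (hFm : MapsTo F U V) {z z₀ : ℂ} (hz : z ∈ U) (hz₀ : z₀ ∈ U) :
    ‖F z - F z₀‖ ≤ 2 * hyperbolicDist U z z₀ * Real.exp (2 * hyperbolicDist U z z₀) *
      Metric.infDist (F z₀) (frontier V) := by
  obtain ⟨φ, ψ, hφd, hφm, hψd, hψm, hinv, -⟩ := exists_isRiemannMap hUo hUc hUne hz
  have hφ : IsRiemannMap U φ := ⟨hφd, hφm, ψ, hψd, hψm, hinv⟩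
  obtain ⟨γ₀, hγ₀⟩ := hφ.exists_contDiffOn_curve hz hz₀
  have hbdd : BddBelow (hyperbolicLength U '' {γ : ℝ → ℂ | ContDiffOn ℝ 1 γ (Icc 0 1) ∧
      MapsTo γ (Icc 0 1) U ∧ γ 0 = z ∧ γ 1 = z₀}) := by
    refine ⟨0, ?_⟩
    rintro _ ⟨γ, ⟨-, hγm, -⟩, rfl⟩
    exact intervalIntegral.integral_nonneg zero_le_one fun t ht =>
      mul_nonneg (hyperbolicDensity_nonneg hUo hφ (hγm ht)) (norm_nonneg _)
  -- No geodesic is needed: the bound is continuous in the length, so it passes to the limit along a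
  -- minimizing sequence.
  obtain ⟨u, -, hu, huS⟩ := exists_seq_tendsto_sInf (Set.Nonempty.image _ ⟨γ₀, hγ₀⟩) hbdd
  change Tendsto u atTop (𝓝 (hyperbolicDist U z z₀)) at hu
  have hcont : Continuous fun L : ℝ => 2 * L * Real.exp (2 * L) *
      Metric.infDist (F z₀) (frontier V) := by fun_prop
  refine ge_of_tendsto' ((hcont.tendsto _).comp hu) fun n => ?_
  obtain ⟨γ, ⟨hγ, hγm, hγz, hγw⟩, hL⟩ := huS n
  have := norm_sub_le_of_curve hUo hUc hUne hVo hVc hVne hF hFm hγ hγm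
  rwa [hL, hγz, hγw] at this

theorem theoremA (U : Set ℂ) (V : ℕ → Set ℂ) (F : ℕ → ℂ → ℂ)
    (hUo : IsOpen U) (hUc : IsSimplyConnected U) (hUne : U ≠ univ)
    (hVo : ∀ n, IsOpen (V n)) (hVc : ∀ n, IsSimplyConnected (V n)) (hVne : ∀ n, V n ≠ univ)
    (hFd : ∀ n, DifferentiableOn ℂ (F n) U) (hFm : ∀ n, MapsTo (F n) U (V n)) :
    (∀ z ∈ U, ∀ z₀ ∈ U, ∀ n,
      ‖F n z - F n z₀‖ ≤ 2 * hyperbolicDist U z z₀ * Real.exp (2 * hyperbolicDist U z z₀) *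
        Metric.infDist (F n z₀) (frontier (V n))) ∧
    (∀ z₀ ∈ U, Tendsto (fun n => Metric.infDist (F n z₀) (frontier (V n))) atTop (𝓝 0) →
      ∀ z ∈ U, Tendsto (fun n => ‖F n z - F n z₀‖) atTop (𝓝 0)) := by
  have hest : ∀ z ∈ U, ∀ z₀ ∈ U, ∀ n,
      ‖F n z - F n z₀‖ ≤ 2 * hyperbolicDist U z z₀ * Real.exp (2 * hyperbolicDist U z z₀) *
        Metric.infDist (F n z₀) (frontier (V n)) := fun z hz z₀ hz₀ n =>
    norm_sub_le_hyperbolicDist hUo hUc hUne (hVo n) (hVc n) (hVne n) (hFd n) (hFm n) hz hz₀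
  refine ⟨hest, fun z₀ hz₀ hlim z hz => ?_⟩
  -- The factor in front of the boundary distance does not depend on n.
  refine squeeze_zero (fun n => norm_nonneg _) (hest z hz z₀ hz₀) ?_
  simpa using hlim.const_mul (2 * hyperbolicDist U z z₀ * Real.exp (2 * hyperbolicDist U z z₀))
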